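/- Let $m,p\ge 0$ be integers with $m>p+2$, let $V>0$ be known and $A\ge 0$, let $X$ be a real $m\times p$ matrix of rank $p$ with rows $\mathbf{x}_1^T,\dots,\mathbf{x}_m^T$, and let $\beta\in\mathbb{R}^p$. Suppose that the random vectors $\theta=(\theta_1,\dots,\theta_m)^T$ and $\mathbf{y}=(y_1,\dots,y_m)^T$ are such that the $\theta_i$ are independent with $\theta_i\sim N(\mathbf{x}_i^T\beta,A)$ and, conditionally on $\theta$, the $y_i$ are independent with $y_i\sim N(\theta_i,V)$. Put $$B=\frac{V}{V+A},\qquad \hat\beta=(X^TX)^{-1}X^T\mathbf{y},\qquad S=\|\mathbf{y}-X\hat\beta\|^2,\qquad \hat B=\frac{V(m-p-2)}{S},$$ let $h_{ii}=\mathbf{x}_i^T(X^TX)^{-1}\mathbf{x}_i$, and let $\hat\theta^{EB}=(1-\hat B)\,\mathbf{y}+\hat B\,X\hat\beta$ be the empirical Bayes (James–Stein) estimator of $\theta$. Then, with expectations taken over the joint distribution of $(\theta,\mathbf{y})$ (and all of them finite): (a) for every $i=1,\dots,m$, $$E\big[(\theta_i-\hat\theta_i^{EB})^2\big]=V(1-B)+VB\,h_{ii}+\frac{2VB(1-h_{ii})}{m-p};$$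 (b) $E\,\|\theta-\hat\theta^{EB}\|^2=V\,[\,m-(m-p-2)B\,]$. -/

import Mathlib

open MeasureTheory ProbabilityTheory
open scoped NNReal Matrix

namespace AreaLevel

/-- A product of independent normal laws `N(θ i, V)` depends measurably on the vector of means. -/
lemma measurable_pi_gaussianReal (m : ℕ) (V : ℝ≥0) :
    Measurable fun θ : Fin m → ℝ => Measure.pi fun i => gaussianReal (θ i) V := by
  refine Measurable.measure_of_isPiSystem_of_isProbabilityMeasure generateFrom_pi.symm
    isPiSystem_pi ?_
  rintro _ ⟨s, hs, rfl⟩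
  simp only [Measure.pi_pi]
  refine Finset.measurable_prod _ fun i _ => ?_
  have h : Measurable fun θ : Fin m → ℝ => gaussianReal (θ i) V :=
    measurable_gaussianReal.comp
      (g := Function.uncurry gaussianReal) (f := fun θ : Fin m → ℝ => (θ i, V))
      ((measurable_pi_apply i).prodMk measurable_const)
  have hsi : MeasurableSet (s i) := hs i (Set.mem_univ i)
  exact (Measure.measurable_coe hsi).comp h

/-- The sampling kernel: given `θ`, the coordinates `y i` are independent with
`y i ∼ N(θ i, V)`. -/
noncomputable def samplingKernel (m : ℕ) (V : ℝ≥0) : Kernel (Fin m → ℝ) (Fin m → ℝ) where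
  toFun θ := Measure.pi fun i => gaussianReal (θ i) V
  measurable' := measurable_pi_gaussianReal m V

/-- The law of `θ`: the coordinates `θ i` are independent with `θ i ∼ N(xᵢᵀβ, A)`, where `xᵢ`
is the `i`-th row of `X`. -/
noncomputable def linkingLaw {m p : ℕ} (X : Matrix (Fin m) (Fin p) ℝ) (β : Fin p → ℝ) (A : ℝ≥0) :
    Measure (Fin m → ℝ) :=
  Measure.pi fun i => gaussianReal (X i ⬝ᵥ β) A

/-- The two-stage normal model: `θ i ∼ N(xᵢᵀβ, A)` independently, and, conditionally on `θ`,
`y i ∼ N(θ i, V)` independently. -/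
structure IsAreaLevelModel {Ω : Type*} [MeasurableSpace Ω] (P : Measure Ω) {m p : ℕ}
    (X : Matrix (Fin m) (Fin p) ℝ) (β : Fin p → ℝ) (V A : ℝ≥0) (θ y : Ω → Fin m → ℝ) : Prop where
  law_theta : HasLaw θ (linkingLaw X β A) P
  law_y_given_theta : HasCondDistrib y θ (samplingKernel m V) P

/-- The shrinkage factor `B = V / (V + A)`. -/
noncomputable def shrinkage (V A : ℝ≥0) : ℝ := (V : ℝ) / (V + A)

/-- The least squares estimator `(XᵀX)⁻¹ Xᵀ y`. -/
noncomputable def betaHat {m p : ℕ} (X : Matrix (Fin m) (Fin p) ℝ) (y : Fin m → ℝ) : Fin p → ℝ :=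
  (Xᵀ * X)⁻¹ *ᵥ (Xᵀ *ᵥ y)

/-- The residual sum of squares `S = ‖y - X β̂‖²` (Euclidean norm). -/
noncomputable def residualSS {m p : ℕ} (X : Matrix (Fin m) (Fin p) ℝ) (y : Fin m → ℝ) : ℝ :=
  ‖WithLp.toLp 2 (y - X *ᵥ betaHat X y)‖ ^ 2

/-- The estimator `V (m - p - 2) / S` of `B`. -/
noncomputable def shrinkageHatEB {m p : ℕ} (X : Matrix (Fin m) (Fin p) ℝ) (V : ℝ≥0)
    (y : Fin m → ℝ) : ℝ :=
  (V : ℝ) * ((m : ℝ) - p - 2) / residualSS X y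

/-- The empirical Bayes (James–Stein) estimator `(1 - B̂) y + B̂ X β̂` of `θ`. -/
noncomputable def thetaHatEB {m p : ℕ} (X : Matrix (Fin m) (Fin p) ℝ) (V : ℝ≥0)
    (y : Fin m → ℝ) : Fin m → ℝ :=
  (1 - shrinkageHatEB X V y) • y + shrinkageHatEB X V y • (X *ᵥ betaHat X y)

/-- The leverage `hᵢᵢ = xᵢᵀ (XᵀX)⁻¹ xᵢ`. -/
noncomputable def leverage {m p : ℕ} (X : Matrix (Fin m) (Fin p) ℝ) (i : Fin m) : ℝ :=
  X i ⬝ᵥ ((Xᵀ * X)⁻¹ *ᵥ X i)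

end AreaLevel

namespace AreaLevel

/-! Write `r = y - X β̂`, `n = m - p`, `v = V + A`. The error of the estimator splits as `θ i - θ̂ i
= [B (θ - Xβ) i - (1 - B) (y - θ) i] - B (X β̂ - Xβ) i + (B̂ - B) r i`. The value of `B` makes the
bracket uncorrelated with `y - Xβ`; by joint normality it is independent of it, with variance `V (1
- B)`. In an orthonormal basis adapted to the column space of `X` and its complement, the
coordinates of `y - Xβ` are i.i.d. `N(0, v)`. The first block gives the second term, of mean square
`B² v hᵢᵢ = V B hᵢᵢ`; the second block gives `r`, with `S` its sum of squares.

Cross terms vanish under a sign change of one coordinate, since `S` is even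
(`integral_sq_sum_mul_even`). By exchangeability the third term contributes `(1 - hᵢᵢ) / n` times
`E[S (c / S - B)²]`, `c = V (n - 2)`. Expanding with `E[1 / S] = 1 / ((n - 2) v)` and `E[S] = n v`
gives `V B (n - 2) - 2 V B (n - 2) + V B n = 2 V B`. Part (b) is the sum over `i`, as the leverages
add up to `p`. -/

/-! ### Laplace transforms and the inverse chi-squared mean -/

lemma integral_exp_neg_mul_sq_gaussianReal {v : ℝ≥0} (hv : 0 < v) {t : ℝ} (ht : 0 ≤ t) :
    ∫ x, Real.exp (-t * x ^ 2) ∂gaussianReal 0 v = (1 + 2 * v * t) ^ (-(1 / 2) : ℝ) := by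
  have hv' : (0 : ℝ) < v := hv
  rw [integral_gaussianReal_eq_integral_smul hv.ne']
  have h : ∀ x : ℝ, gaussianPDFReal 0 v x • Real.exp (-t * x ^ 2)
      = (√(2 * Real.pi * v))⁻¹ * Real.exp (-(t + 1 / (2 * v)) * x ^ 2) := by
    intro x
    rw [gaussianPDFReal, smul_eq_mul, mul_assoc, ← Real.exp_add]
    congr 2
    field_simp
    ring
  simp_rw [h]
  rw [integral_const_mul, integral_gaussian, ← Real.sqrt_inv, ← Real.sqrt_mul (by positivity),
    Real.rpow_neg (by positivity), ← Real.sqrt_eq_rpow, ← Real.sqrt_inv]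
  congr 1
  have := Real.pi_pos
  field_simp
  ring

lemma integral_exp_neg_mul_sum_sq_pi_gaussianReal {η : Type*} [Fintype η] {v : ℝ≥0} (hv : 0 < v)
    {t : ℝ} (ht : 0 ≤ t) :
    ∫ x : η → ℝ, Real.exp (-t * ∑ j, x j ^ 2) ∂Measure.pi (fun _ => gaussianReal 0 v)
      = (1 + 2 * v * t) ^ (-(Fintype.card η / 2) : ℝ) := by
  simp_rw [Finset.mul_sum, Real.exp_sum]
  rw [integral_fintype_prod_eq_pow (fun y : ℝ => Real.exp (-t * y ^ 2)),
    integral_exp_neg_mul_sq_gaussianReal hv ht, ← Real.rpow_natCast, ← Real.rpow_mul (by positivity)]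
  congr 1
  ring

lemma integral_Ioi_one_add_mul_rpow {a r : ℝ} (ha : 0 < a) (hr : 1 < r) :
    IntegrableOn (fun t : ℝ => (1 + a * t) ^ (-r)) (Set.Ioi 0) ∧
    ∫ t in Set.Ioi (0 : ℝ), (1 + a * t) ^ (-r) = 1 / (a * (r - 1)) := by
  have hr' : r - 1 ≠ 0 := by linarith
  have hd : ∀ t ∈ Set.Ici (0 : ℝ), HasDerivAt
      (fun t : ℝ => -(1 / (a * (r - 1))) * (1 + a * t) ^ (-(r - 1))) ((1 + a * t) ^ (-r)) t := by
    intro t ht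
    have ht : 0 ≤ t := ht
    have h1 : HasDerivAt (fun t : ℝ => 1 + a * t) a t := by
      simpa using ((hasDerivAt_id t).const_mul a).const_add 1
    have h2 := (h1.rpow_const (p := -(r - 1)) (Or.inl (by positivity))).const_mul
      (-(1 / (a * (r - 1))))
    convert! h2 using 1
    rw [show -(r - 1) - 1 = -r by ring]
    field_simp
  have hpos : ∀ t ∈ Set.Ioi (0 : ℝ), 0 ≤ (1 + a * t) ^ (-r) := by
    intro t ht
    have ht : 0 < t := ht
    positivity
  have hlim : Filter.Tendsto (fun t : ℝ => -(1 / (a * (r - 1))) * (1 + a * t) ^ (-(r - 1)))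
      Filter.atTop (nhds 0) := by
    have h1 : Filter.Tendsto (fun t : ℝ => 1 + a * t) Filter.atTop Filter.atTop :=
      Filter.tendsto_atTop_add_const_left _ _ (Filter.tendsto_id.const_mul_atTop ha)
    simpa using ((tendsto_rpow_neg_atTop (y := r - 1) (by linarith)).comp h1).const_mul
      (-(1 / (a * (r - 1))))
  refine ⟨integrableOn_Ioi_deriv_of_nonneg' hd hpos hlim, ?_⟩
  rw [integral_Ioi_of_hasDerivAt_of_nonneg' hd hpos hlim]
  simp

/-- Needed because `s⁻¹ = ∫ exp (-t s) dt` over `t > 0` fails at `s = 0`, where `0⁻¹ = 0` and the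
integral diverges. -/
lemma ae_sum_sq_pos_pi_gaussianReal {η : Type*} [Fintype η] [Nonempty η] {v : ℝ≥0} (hv : 0 < v) :
    ∀ᵐ x : η → ℝ ∂Measure.pi (fun _ => gaussianReal 0 v), 0 < ∑ j, x j ^ 2 := by
  obtain ⟨j⟩ := ‹Nonempty η›
  have := nullSingletonClass_gaussianReal (μ := 0) hv.ne'
  have h : ∀ᵐ x : η → ℝ ∂Measure.pi (fun _ => gaussianReal 0 v), x j ≠ 0 := by
    refine (measurePreserving_eval (fun _ : η => gaussianReal 0 v) j).quasiMeasurePreserving.ae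
      (p := fun t : ℝ => t ≠ 0) ?_
    simp [ae_iff]
  filter_upwards [h] with x hx
  exact (by positivity : 0 < x j ^ 2).trans_le
    (Finset.single_le_sum (fun i _ => sq_nonneg (x i)) (Finset.mem_univ j))

/-- Represent `s⁻¹` as the integral of `exp (-t s)` over `t > 0` and apply Tonelli: the Laplace
transform factors over coordinates into `(1 + 2 v t) ^ (-n / 2)`, integrable at infinity because `n
> 2`. Working with `∫⁻` yields integrability as well as the value. -/
lemma lintegral_inv_sum_sq_pi_gaussianReal {η : Type*} [Fintype η] (hη : 2 < Fintype.card η)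
    {v : ℝ≥0} (hv : 0 < v) :
    ∫⁻ x : η → ℝ, ENNReal.ofReal (∑ j, x j ^ 2)⁻¹ ∂Measure.pi (fun _ => gaussianReal 0 v)
      = ENNReal.ofReal (1 / (((Fintype.card η : ℝ) - 2) * v)) := by
  have hv' : (0 : ℝ) < v := hv
  have hη' : (2 : ℝ) < Fintype.card η := by exact_mod_cast hη
  have : Nonempty η := Fintype.card_pos_iff.mp (by omega)
  calc ∫⁻ x : η → ℝ, ENNReal.ofReal (∑ j, x j ^ 2)⁻¹ ∂Measure.pi (fun _ : η => gaussianReal 0 v)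
      = ∫⁻ x : η → ℝ, (∫⁻ t in Set.Ioi (0 : ℝ), ENNReal.ofReal (Real.exp (-t * ∑ j, x j ^ 2)))
          ∂Measure.pi (fun _ : η => gaussianReal 0 v) := by
        refine lintegral_congr_ae ?_
        filter_upwards [ae_sum_sq_pos_pi_gaussianReal (η := η) hv] with x hx
        have h1 := integrableOn_exp_mul_Ioi (neg_lt_zero.mpr hx) 0
        have h2 := integral_exp_mul_Ioi (neg_lt_zero.mpr hx) 0
        have h3 : ∀ t : ℝ, -(∑ j, x j ^ 2) * t = -t * ∑ j, x j ^ 2 := fun t => by ring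
        simp_rw [h3] at h1 h2
        rw [← ofReal_integral_eq_lintegral_ofReal h1
          (Filter.Eventually.of_forall fun t => (Real.exp_pos _).le), h2]
        simp [neg_div_neg_eq]
    _ = ∫⁻ t in Set.Ioi (0 : ℝ), ∫⁻ x : η → ℝ, ENNReal.ofReal (Real.exp (-t * ∑ j, x j ^ 2))
          ∂Measure.pi (fun _ : η => gaussianReal 0 v) := by
        refine lintegral_lintegral_swap ?_
        fun_prop
    _ = ∫⁻ t in Set.Ioi (0 : ℝ),
          ENNReal.ofReal ((1 + 2 * v * t) ^ (-(Fintype.card η / 2) : ℝ)) := by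
        refine setLIntegral_congr_fun measurableSet_Ioi fun t ht => ?_
        have ht : 0 < t := ht
        rw [← integral_exp_neg_mul_sum_sq_pi_gaussianReal hv ht.le,
          ofReal_integral_eq_lintegral_ofReal ?_
            (Filter.Eventually.of_forall fun t => (Real.exp_pos _).le)]
        have hm : Measurable fun x : η → ℝ => Real.exp (-t * ∑ j, x j ^ 2) := by fun_prop
        refine Integrable.of_bound hm.aestronglyMeasurable 1 (Filter.Eventually.of_forall fun x => ?_)
        rw [Real.norm_eq_abs, Real.abs_exp, Real.exp_le_one_iff]
        have : 0 ≤ ∑ j, x j ^ 2 := Finset.sum_nonneg fun j _ => sq_nonneg _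
        nlinarith
    _ = ENNReal.ofReal (1 / (((Fintype.card η : ℝ) - 2) * v)) := by
        obtain ⟨h1, h2⟩ := integral_Ioi_one_add_mul_rpow (a := 2 * v)
          (r := (Fintype.card η : ℝ) / 2) (by positivity) (by linarith)
        rw [← ofReal_integral_eq_lintegral_ofReal h1, h2]
        · congr 2
          ring
        · filter_upwards [ae_restrict_mem measurableSet_Ioi] with t ht
          have ht : 0 < t := ht
          change 0 ≤ _
          positivity

/-- The mean of an inverse chi-squared variable. -/
lemma integral_inv_sum_sq_pi_gaussianReal {η : Type*} [Fintype η] (hη : 2 < Fintype.card η)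
    {v : ℝ≥0} (hv : 0 < v) :
    Integrable (fun x : η → ℝ => (∑ j, x j ^ 2)⁻¹) (Measure.pi fun _ => gaussianReal 0 v) ∧
    ∫ x : η → ℝ, (∑ j, x j ^ 2)⁻¹ ∂Measure.pi (fun _ => gaussianReal 0 v)
      = 1 / (((Fintype.card η : ℝ) - 2) * v) := by
  have hη' : (2 : ℝ) < Fintype.card η := by exact_mod_cast hη
  have h0 : 0 ≤ᵐ[Measure.pi fun _ => gaussianReal 0 v] fun x : η → ℝ => (∑ j, x j ^ 2)⁻¹ :=
    Filter.Eventually.of_forall fun x =>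
      inv_nonneg.mpr (Finset.sum_nonneg fun j _ => sq_nonneg (x j))
  have hm : AEStronglyMeasurable (fun x : η → ℝ => (∑ j, x j ^ 2)⁻¹)
      (Measure.pi fun _ => gaussianReal 0 v) := by
    have : Measurable fun x : η → ℝ => (∑ j, x j ^ 2)⁻¹ := by fun_prop
    exact this.aestronglyMeasurable
  have hl := lintegral_inv_sum_sq_pi_gaussianReal hη hv
  refine ⟨(lintegral_ofReal_ne_top_iff_integrable hm h0).mp (by rw [hl]; exact ENNReal.ofReal_ne_top), ?_⟩
  rw [integral_eq_lintegral_of_nonneg_ae h0 hm, hl, ENNReal.toReal_ofReal]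
  have : (0 : ℝ) < Fintype.card η - 2 := by linarith
  positivity

/-! ### Symmetries and second moments in canonical coordinates -/

/-- A product of centred normal laws is invariant under a sign change of one coordinate. -/
lemma measurePreserving_flip_pi_gaussianReal {ι : Type*} [Fintype ι] [DecidableEq ι] (τ : ι → ℝ≥0)
    (k : ι) :
    MeasurePreserving (fun (x : ι → ℝ) i => if i = k then -x i else x i)
      (Measure.pi fun i => gaussianReal 0 (τ i)) (Measure.pi fun i => gaussianReal 0 (τ i)) := by
  refine measurePreserving_pi _ _ (f := fun i t => if i = k then -t else t) fun i => ?_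
  by_cases h : i = k
  · simp only [h, if_true]
    exact ⟨measurable_neg, by rw [gaussianReal_map_neg, neg_zero]⟩
  · simp only [h, if_false]
    exact MeasurePreserving.id _

/-- The flip preserves the measure, so the integral equals its own negative. Integrability is not
required. -/
lemma integral_eq_zero_of_flip {ι : Type*} [Fintype ι] [DecidableEq ι] (τ : ι → ℝ≥0) (k : ι)
    {f : (ι → ℝ) → ℝ} (hf : Measurable f)
    (h : ∀ x, f (fun i => if i = k then -x i else x i) = -f x) :
    ∫ x, f x ∂Measure.pi (fun i => gaussianReal 0 (τ i)) = 0 := by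
  have hp := measurePreserving_flip_pi_gaussianReal τ k
  have h1 : ∫ x, f x ∂Measure.pi (fun i => gaussianReal 0 (τ i))
      = -∫ x, f x ∂Measure.pi (fun i => gaussianReal 0 (τ i)) := by
    conv_lhs => rw [← hp.map_eq]
    rw [integral_map hp.measurable.aemeasurable hf.aestronglyMeasurable]
    simp_rw [h]
    exact integral_neg _
  linarith

/-- Exchangeability of an i.i.d. sample. -/
lemma integral_pi_const_swap {η : Type*} [Fintype η] [DecidableEq η] (ν : Measure ℝ)
    [SigmaFinite ν] (f : (η → ℝ) → ℝ) (σ : Equiv.Perm η) :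
    ∫ x, f (fun i => x (σ i)) ∂Measure.pi (fun _ : η => ν) = ∫ x, f x ∂Measure.pi fun _ => ν := by
  have h := (measurePreserving_piCongrLeft (fun _ : η => ν) σ.symm).integral_comp' f
  rw [← h]
  refine integral_congr_ae (Filter.Eventually.of_forall fun x => ?_)
  refine congrArg f (funext fun i => ?_)
  have := Equiv.piCongrLeft_apply_apply (fun _ : η => ℝ) σ.symm x (σ i)
  simp only [Equiv.symm_apply_apply] at this
  exact this.symm

/-- Swapping two coordinates fixes the sum of squares, so all coordinates contribute equally. -/
lemma integral_sq_mul_sum_sq_eq {η : Type*} [Fintype η] (ν : Measure ℝ)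
    [SigmaFinite ν] (g : ℝ → ℝ) (j : η)
    (hi : ∀ k, Integrable (fun x : η → ℝ => x k ^ 2 * g (∑ l, x l ^ 2)) (Measure.pi fun _ => ν)) :
    (Fintype.card η : ℝ) * ∫ x : η → ℝ, x j ^ 2 * g (∑ l, x l ^ 2) ∂Measure.pi (fun _ => ν)
      = ∫ x : η → ℝ, (∑ l, x l ^ 2) * g (∑ l, x l ^ 2) ∂Measure.pi (fun _ => ν) := by
  classical
  have h : ∀ k, ∫ x : η → ℝ, x k ^ 2 * g (∑ l, x l ^ 2) ∂Measure.pi (fun _ => ν)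
      = ∫ x : η → ℝ, x j ^ 2 * g (∑ l, x l ^ 2) ∂Measure.pi (fun _ => ν) := by
    intro k
    rw [← integral_pi_const_swap ν (fun x : η → ℝ => x j ^ 2 * g (∑ l, x l ^ 2))
      (Equiv.swap j k)]
    refine integral_congr_ae (Filter.Eventually.of_forall fun x => ?_)
    simp only [Equiv.swap_apply_left]
    rw [Equiv.sum_comp (Equiv.swap j k) fun l => x l ^ 2]
  simp_rw [Finset.sum_mul]
  rw [integral_finsetSum _ fun k _ => hi k, Finset.sum_congr rfl fun k _ => h k]
  simp

lemma memLp_two_eval_pi_gaussianReal {ι : Type*} [Fintype ι] (τ : ι → ℝ≥0) (k : ι) :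
    MemLp (fun x : ι → ℝ => x k) 2 (Measure.pi fun i => gaussianReal 0 (τ i)) :=
  (memLp_id_gaussianReal (μ := 0) (v := τ k) 2).comp_measurePreserving
    (measurePreserving_eval (fun i => gaussianReal 0 (τ i)) k)

lemma integral_eval_sq_pi_gaussianReal {ι : Type*} [Fintype ι] (τ : ι → ℝ≥0) (k : ι) :
    ∫ x : ι → ℝ, x k ^ 2 ∂(Measure.pi fun i => gaussianReal 0 (τ i)) = τ k := by
  have hp := measurePreserving_eval (fun i => gaussianReal 0 (τ i)) k
  have h1 : ∫ t : ℝ, t ^ 2 ∂gaussianReal 0 (τ k) = τ k := by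
    rw [← variance_id_gaussianReal (μ := 0) (v := τ k),
      variance_of_integral_eq_zero aemeasurable_id (by simp)]
    rfl
  rw [← h1, ← hp.map_eq, integral_map hp.measurable.aemeasurable (by fun_prop)]

/-- The square of `x j / S` is at most `1 / S`, which is integrable. -/
lemma memLp_two_mul_inv_sum_sq_sub {η : Type*} [Fintype η] (hη : 2 < Fintype.card η)
    {v : ℝ≥0} (hv : 0 < v) (c b : ℝ) (j : η) :
    MemLp (fun x : η → ℝ => x j * (c * (∑ l, x l ^ 2)⁻¹ - b)) 2
      (Measure.pi fun _ => gaussianReal 0 v) := by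
  have h1 : MemLp (fun x : η → ℝ => x j * (∑ l, x l ^ 2)⁻¹) 2
      (Measure.pi fun _ => gaussianReal 0 v) := by
    have hm : Measurable fun x : η → ℝ => x j * (∑ l, x l ^ 2)⁻¹ := by fun_prop
    rw [memLp_two_iff_integrable_sq hm.aestronglyMeasurable]
    refine (integral_inv_sum_sq_pi_gaussianReal hη hv).1.mono' (by fun_prop)
      (Filter.Eventually.of_forall fun x => ?_)
    have h0 : 0 ≤ ∑ l, x l ^ 2 := Finset.sum_nonneg fun l _ => sq_nonneg _
    have hj : x j ^ 2 ≤ ∑ l, x l ^ 2 :=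
      Finset.single_le_sum (fun i _ => sq_nonneg (x i)) (Finset.mem_univ j)
    rw [Real.norm_of_nonneg (sq_nonneg _), mul_pow]
    rcases h0.eq_or_lt with h | h
    · rw [← h]; simp
    · calc x j ^ 2 * (∑ l, x l ^ 2)⁻¹ ^ 2 ≤ (∑ l, x l ^ 2) * (∑ l, x l ^ 2)⁻¹ ^ 2 := by gcongr
        _ = (∑ l, x l ^ 2)⁻¹ := by field_simp
  have h2 := (h1.const_mul c).sub ((memLp_two_eval_pi_gaussianReal (fun _ : η => v) j).const_mul b)
  refine h2.ae_eq (Filter.Eventually.of_forall fun x => ?_)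
  simp only [Pi.sub_apply]
  ring

/-- Exchangeability reduces this to the mean of `S (c / S - b)² = c² / S - 2 c b + b² S`. -/
lemma integral_sq_mul_inv_sum_sq_sub_sq {η : Type*} [Fintype η] (hη : 2 < Fintype.card η)
    {v : ℝ≥0} (hv : 0 < v) (c b : ℝ) (j : η) :
    ∫ x : η → ℝ, (x j * (c * (∑ l, x l ^ 2)⁻¹ - b)) ^ 2 ∂Measure.pi (fun _ => gaussianReal 0 v)
      = (c ^ 2 / (((Fintype.card η : ℝ) - 2) * v) - 2 * c * b + b ^ 2 * (Fintype.card η * v))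
        / Fintype.card η := by
  have hη' : (2 : ℝ) < Fintype.card η := by exact_mod_cast hη
  have : Nonempty η := ⟨j⟩
  have hi : ∀ k, Integrable (fun x : η → ℝ => x k ^ 2 * (c * (∑ l, x l ^ 2)⁻¹ - b) ^ 2)
      (Measure.pi fun _ => gaussianReal 0 v) := fun k => by
    simpa only [mul_pow] using (memLp_two_mul_inv_sum_sq_sub hη hv c b k).integrable_sq
  have h := integral_sq_mul_sum_sq_eq (gaussianReal 0 v) (fun s => (c * s⁻¹ - b) ^ 2) j hi
  obtain ⟨hinv, hinv'⟩ := integral_inv_sum_sq_pi_gaussianReal hη hv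
  have hsq : ∀ k, Integrable (fun x : η → ℝ => x k ^ 2) (Measure.pi fun _ => gaussianReal 0 v) :=
    fun k => (memLp_two_eval_pi_gaussianReal (fun _ : η => v) k).integrable_sq
  simp_rw [mul_pow]
  rw [eq_div_iff (by positivity), mul_comm, h]
  calc ∫ x : η → ℝ, (∑ l, x l ^ 2) * (c * (∑ l, x l ^ 2)⁻¹ - b) ^ 2
        ∂Measure.pi (fun _ => gaussianReal 0 v)
      = ∫ x : η → ℝ, (c ^ 2 * (∑ l, x l ^ 2)⁻¹ - 2 * c * b + b ^ 2 * ∑ l, x l ^ 2)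
        ∂Measure.pi (fun _ => gaussianReal 0 v) := by
        refine integral_congr_ae ?_
        filter_upwards [ae_sum_sq_pos_pi_gaussianReal (η := η) hv] with x hx
        field_simp
        ring
    _ = _ := by
        have hS := integrable_finsetSum Finset.univ fun k _ => hsq k
        have hd : Integrable (fun x : η → ℝ => c ^ 2 * (∑ l, x l ^ 2)⁻¹ - 2 * c * b)
            (Measure.pi fun _ => gaussianReal 0 v) := (hinv.const_mul _).sub (integrable_const _)
        rw [integral_add hd (hS.const_mul _), integral_sub (hinv.const_mul _) (integrable_const _), integral_const_mul,
          integral_const_mul (b ^ 2), hinv', integral_finsetSum _ fun k _ => hsq k,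
          Finset.sum_congr rfl fun k _ => integral_eval_sq_pi_gaussianReal (fun _ : η => v) k,
          mul_one_div]
        simp

/-- Odd terms in distinct independent centred normal coordinates are orthogonal. -/
lemma integral_sq_sum_mul_even {ι : Type*} [Fintype ι] [DecidableEq ι] (τ : ι → ℝ≥0)
    (g : ι → (ι → ℝ) → ℝ) (hg : ∀ k, Measurable (g k))
    (heven : ∀ k l x, g k (fun i => if i = l then -x i else x i) = g k x)
    (hL : ∀ k, MemLp (fun x : ι → ℝ => x k * g k x) 2 (Measure.pi fun i => gaussianReal 0 (τ i)))
    (a : ι → ℝ) :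
    MemLp (fun x : ι → ℝ => ∑ k, a k * (x k * g k x)) 2
      (Measure.pi fun i => gaussianReal 0 (τ i)) ∧
    ∫ x : ι → ℝ, (∑ k, a k * (x k * g k x)) ^ 2 ∂Measure.pi (fun i => gaussianReal 0 (τ i))
      = ∑ k, a k ^ 2 * ∫ x : ι → ℝ, (x k * g k x) ^ 2
          ∂Measure.pi (fun i => gaussianReal 0 (τ i)) := by
  refine ⟨memLp_finsetSum _ fun k _ => (hL k).const_mul (a k), ?_⟩
  have hint : ∀ k l, Integrable (fun x : ι → ℝ => a k * (x k * g k x) * (a l * (x l * g l x)))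
      (Measure.pi fun i => gaussianReal 0 (τ i)) := fun k l =>
    ((hL k).const_mul (a k)).integrable_mul ((hL l).const_mul (a l))
  simp_rw [pow_two (∑ k, _), Finset.sum_mul_sum]
  rw [integral_finsetSum _ fun k _ => integrable_finsetSum _ fun l _ => hint k l]
  refine Finset.sum_congr rfl fun k _ => ?_
  rw [integral_finsetSum _ fun l _ => hint k l, Finset.sum_eq_single k]
  · rw [← integral_const_mul]
    congr 1
    funext x
    ring
  · intro l _ hlk
    -- For `l ≠ k` the integrand is odd in `x k`: both factors `g` are even and `x l` is unchanged.
    refine integral_eq_zero_of_flip τ k ?_ fun x => ?_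
    · have := hg k
      have := hg l
      fun_prop
    · rw [heven, heven]
      simp only [if_true, if_neg hlk]
      ring
  · simp

/-- The second moment of the error of a shrinkage estimator, in canonical coordinates: the
coordinates in `κ` enter linearly, those in `η` are shrunk by a factor that depends on their
sum of squares. -/
lemma integral_sq_canonical_error {κ η : Type*} [Fintype κ] [Fintype η]
    (hη : 2 < Fintype.card η) (τ : κ → ℝ≥0) {v : ℝ≥0} (hv : 0 < v) (c b : ℝ)
    (a : κ → ℝ) (d : η → ℝ) :
    MemLp (fun x : κ ⊕ η → ℝ => ∑ k, a k * x (.inl k)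
        + ∑ j, d j * (x (.inr j) * (c * (∑ l, x (.inr l) ^ 2)⁻¹ - b))) 2
      (Measure.pi fun i => gaussianReal 0 (Sum.elim τ (fun _ => v) i)) ∧
    ∫ x : κ ⊕ η → ℝ, (∑ k, a k * x (.inl k)
        + ∑ j, d j * (x (.inr j) * (c * (∑ l, x (.inr l) ^ 2)⁻¹ - b))) ^ 2
      ∂Measure.pi (fun i => gaussianReal 0 (Sum.elim τ (fun _ => v) i))
      = ∑ k, a k ^ 2 * τ k + (∑ j, d j ^ 2) *
        ((c ^ 2 / (((Fintype.card η : ℝ) - 2) * v) - 2 * c * b + b ^ 2 * (Fintype.card η * v))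
        / Fintype.card η) := by
  classical
  -- Both kinds of coordinate have the form `x k * g k x` with `g k` even in every coordinate; the
  -- linear ones have `g k = 1`.
  let g : κ ⊕ η → (κ ⊕ η → ℝ) → ℝ := Sum.elim (fun _ _ => 1)
    (fun _ x => c * (∑ l, x (.inr l) ^ 2)⁻¹ - b)
  have hmp : MeasurePreserving (fun (x : κ ⊕ η → ℝ) j => x (.inr j))
      (Measure.pi fun i => gaussianReal 0 (Sum.elim τ (fun _ => v) i))
      (Measure.pi fun _ => gaussianReal 0 v) :=
    measurePreserving_snd.comp
      (measurePreserving_sumPiEquivProdPi fun i : κ ⊕ η => gaussianReal 0 (Sum.elim τ (fun _ => v) i))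
  have hg : ∀ k, Measurable (g k) := by
    rintro (k | j)
    · exact measurable_const
    · change Measurable fun x : κ ⊕ η → ℝ => c * (∑ l, x (.inr l) ^ 2)⁻¹ - b
      fun_prop
  have heven : ∀ k l x, g k (fun i => if i = l then -x i else x i) = g k x := by
    rintro (k | j) l x
    · rfl
    · change c * (∑ m, (if Sum.inr m = l then -x (.inr m) else x (.inr m)) ^ 2)⁻¹ - b = _
      have : ∀ m : η, (if Sum.inr m = l then -x (.inr m) else x (.inr m)) ^ 2
          = x (.inr m) ^ 2 := fun m => by split_ifs <;> simp
      simp_rw [this]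
      rfl
  have hL : ∀ k, MemLp (fun x : κ ⊕ η → ℝ => x k * g k x) 2
      (Measure.pi fun i => gaussianReal 0 (Sum.elim τ (fun _ => v) i)) := by
    rintro (k | j)
    · simpa [g] using memLp_two_eval_pi_gaussianReal (Sum.elim τ fun _ : η => v) (.inl k)
    · exact (memLp_two_mul_inv_sum_sq_sub hη hv c b j).comp_measurePreserving hmp
  have h := integral_sq_sum_mul_even (Sum.elim τ fun _ : η => v) g hg heven hL (Sum.elim a d)
  simp only [Fintype.sum_sum_type, Sum.elim_inl, Sum.elim_inr, g, mul_one] at h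
  refine ⟨h.1, h.2.trans ?_⟩
  congr 1
  · refine Finset.sum_congr rfl fun k _ => ?_
    rw [integral_eval_sq_pi_gaussianReal (Sum.elim τ fun _ : η => v) (.inl k)]
    rfl
  · rw [Finset.sum_mul]
    refine Finset.sum_congr rfl fun j _ => ?_
    rw [← integral_sq_mul_inv_sum_sq_sub_sq hη hv c b j, ← hmp.map_eq,
      integral_map hmp.measurable.aemeasurable]
    have : Measurable fun x : η → ℝ => (x j * (c * (∑ l, x l ^ 2)⁻¹ - b)) ^ 2 := by fun_prop
    exact this.aestronglyMeasurable

/-! ### Normal laws of the errors and their linear combinations -/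

/-- Uncorrelated linear combinations of independent centred normal variables are independent
centred normal variables. -/
lemma hasLaw_linear_combination_pi_gaussianReal {Ω : Type*} [MeasurableSpace Ω] {P : Measure Ω}
    [IsProbabilityMeasure P] {ι κ : Type*} [Fintype ι] [Fintype κ] [DecidableEq ι]
    {N : Ω → ι → ℝ} {τ : ι → ℝ≥0} (hN : HasLaw N (Measure.pi fun s => gaussianReal 0 (τ s)) P)
    (M : κ → ι → ℝ) (u : κ → ℝ≥0) (hu : ∀ k, ∑ s, M k s ^ 2 * τ s = u k)
    (hM : ∀ k l, k ≠ l → ∑ s, M k s * M l s * τ s = 0) :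
    HasLaw (fun ω k => ∑ s, M k s * N ω s) (Measure.pi fun k => gaussianReal 0 (u k)) P := by
  have hNs : ∀ s, HasLaw (fun ω => N ω s) (gaussianReal 0 (τ s)) P := fun s =>
    (measurePreserving_eval (fun s => gaussianReal 0 (τ s)) s).hasLaw.comp hN
  have hind : iIndepFun (fun s ω => N ω s) P := by
    rw [iIndepFun_iff_map_fun_eq_pi_map fun s => (hNs s).aemeasurable]
    simp_rw [fun s => (hNs s).map_eq]
    exact hN.map_eq
  have hG : HasGaussianLaw (fun ω s => N ω s) P :=
    hind.hasGaussianLaw fun s => (hNs s).hasGaussianLaw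
  -- Joint normality of the image vector is what lets zero covariances give independence.
  have hU : HasGaussianLaw (fun ω k => ∑ s, M k s * N ω s) P := by
    have := hG.map_fun (LinearMap.toContinuousLinearMap (Matrix.mulVecLin (Matrix.of M)))
    exact this
  have hcovN : ∀ s t, cov[fun ω => N ω s, fun ω => N ω t; P] = if s = t then (τ s : ℝ) else 0 := by
    intro s t
    split_ifs with h
    · subst h
      rw [covariance_self (hNs s).aemeasurable, (hNs s).variance_eq, variance_id_gaussianReal]
    · exact (hind.indepFun h).covariance_eq_zero (hNs s).hasGaussianLaw.memLp_two
        (hNs t).hasGaussianLaw.memLp_two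
  have hcov : ∀ k l, cov[fun ω => ∑ s, M k s * N ω s, fun ω => ∑ s, M l s * N ω s; P]
      = ∑ s, M k s * M l s * τ s := by
    intro k l
    rw [covariance_fun_sum_fun_sum
      (fun s => (hNs s).hasGaussianLaw.memLp_two.const_mul (M k s))
      (fun s => (hNs s).hasGaussianLaw.memLp_two.const_mul (M l s))]
    simp_rw [covariance_const_mul_left, covariance_const_mul_right, hcovN]
    simp [mul_assoc]
  have hi : iIndepFun (fun k ω => ∑ s, M k s * N ω s) P :=
    hU.iIndepFun_of_covariance_eq_zero fun k l hkl => by rw [hcov, hM k l hkl]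
  refine hi.hasLaw_pi fun k => ⟨(hU.eval k).aemeasurable, ?_⟩
  rw [(hU.eval k).map_eq_gaussianReal]
  congr 1
  · rw [integral_finsetSum _ fun s _ => (hNs s).hasGaussianLaw.integrable.const_mul _]
    refine Finset.sum_eq_zero fun s _ => ?_
    rw [integral_const_mul, (hNs s).integral_eq]
    simp
  · rw [← covariance_self (hU.eval k).aemeasurable, hcov]
    simp_rw [← pow_two, hu]
    simp

instance isMarkovKernel_samplingKernel (m : ℕ) (V : ℝ≥0) : IsMarkovKernel (samplingKernel m V) :=
  ⟨fun θ => inferInstanceAs (IsProbabilityMeasure (Measure.pi fun i => gaussianReal (θ i) V))⟩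

lemma map_sub_pi_gaussianReal {m : ℕ} (V : ℝ≥0) (μ : Fin m → ℝ) :
    (Measure.pi fun i => gaussianReal (μ i) V).map (fun y => y - μ)
      = Measure.pi fun _ => gaussianReal 0 V := by
  have hp : MeasurePreserving (fun (y : Fin m → ℝ) i => y i - μ i)
      (Measure.pi fun i => gaussianReal (μ i) V) (Measure.pi fun _ => gaussianReal 0 V) :=
    measurePreserving_pi _ _ (f := fun i t => t - μ i) fun i =>
      ⟨by fun_prop, by rw [gaussianReal_map_sub_const, sub_self]⟩
  exact hp.map_eq

/-- Given `θ`, the law of `y - θ` does not depend on `θ`, so the shear `(θ, y) ↦ (θ, y - θ)`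
produces a product measure. -/
lemma map_compProd_samplingKernel {m : ℕ} (V : ℝ≥0) (Q : Measure (Fin m → ℝ)) [SFinite Q] :
    (Q ⊗ₘ samplingKernel m V).map (fun z => (z.1, z.2 - z.1))
      = Q.prod (Measure.pi fun _ => gaussianReal 0 V) := by
  ext s hs
  have hT : Measurable fun z : (Fin m → ℝ) × (Fin m → ℝ) => (z.1, z.2 - z.1) := by fun_prop
  rw [Measure.map_apply hT hs, Measure.compProd_apply (hT hs), Measure.prod_apply hs]
  refine lintegral_congr fun x => ?_
  rw [← map_sub_pi_gaussianReal V x, Measure.map_apply (by fun_prop) (measurable_prodMk_left hs)]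
  rfl

/-- In the two-stage normal model the random effects `θ - Xβ` and the sampling errors `y - θ`
are independent centred normal variables. -/
lemma IsAreaLevelModel.hasLaw_errors {Ω : Type*} [MeasurableSpace Ω] {P : Measure Ω}
    {m p : ℕ} {X : Matrix (Fin m) (Fin p) ℝ} {β : Fin p → ℝ}
    {V A : ℝ≥0} {θ y : Ω → Fin m → ℝ} (h : IsAreaLevelModel P X β V A θ y) :
    HasLaw (fun ω => (Sum.elim (θ ω - X *ᵥ β) (y ω - θ ω) : Fin m ⊕ Fin m → ℝ))
      (Measure.pi fun s => gaussianReal 0 (Sum.elim (fun _ => A) (fun _ => V) s)) P := by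
  have hθ := h.law_theta
  have : IsProbabilityMeasure (linkingLaw X β A) :=
    inferInstanceAs (IsProbabilityMeasure (Measure.pi fun i => gaussianReal (X i ⬝ᵥ β) A))
  have h1 := hθ.prodMk_of_hasCondDistrib h.law_y_given_theta
  have h2 : HasLaw (fun ω => (θ ω, y ω - θ ω))
      ((linkingLaw X β A).prod (Measure.pi fun _ => gaussianReal 0 V)) P :=
    HasLaw.fun_comp (Y := fun z : (Fin m → ℝ) × (Fin m → ℝ) => (z.1, z.2 - z.1))
      ⟨by fun_prop, map_compProd_samplingKernel V _⟩ h1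
  have h3 : MeasurePreserving (Prod.map (fun x : Fin m → ℝ => x - X *ᵥ β) (id : (Fin m → ℝ) → _))
      ((linkingLaw X β A).prod (Measure.pi fun _ => gaussianReal 0 V))
      ((Measure.pi fun _ => gaussianReal 0 A).prod (Measure.pi fun _ => gaussianReal 0 V)) :=
    MeasurePreserving.prod ⟨by fun_prop, map_sub_pi_gaussianReal A (X *ᵥ β)⟩
      (MeasurePreserving.id _)
  have h4 := (measurePreserving_sumPiEquivProdPi_symm
    fun s : Fin m ⊕ Fin m => gaussianReal 0 (Sum.elim (fun _ => A) (fun _ => V) s)).fun_comp_hasLaw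
      (h3.fun_comp_hasLaw h2)
  convert! h4 using 2 with ω

/-! ### Least squares as orthogonal projection -/

lemma isUnit_det_transpose_mul_self {m p : ℕ} {X : Matrix (Fin m) (Fin p) ℝ} (hX : X.rank = p) :
    IsUnit (Xᵀ * X).det := by
  have h : Function.Injective (Xᵀ * X).mulVecLin := by
    rw [← LinearMap.ker_eq_bot, ← Submodule.finrank_eq_zero]
    have h1 := (Xᵀ * X).mulVecLin.finrank_range_add_finrank_ker
    have h2 : Module.finrank ℝ (Xᵀ * X).mulVecLin.range = p :=
      (Matrix.rank_transpose_mul_self X).trans hX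
    simp only [Module.finrank_fintype_fun_eq_card, Fintype.card_fin] at h1
    omega
  rw [← Matrix.isUnit_iff_isUnit_det]
  exact Matrix.mulVec_injective_iff_isUnit.mp h

lemma betaHat_mulVec {m p : ℕ} {X : Matrix (Fin m) (Fin p) ℝ} (hX : X.rank = p) (β : Fin p → ℝ) :
    betaHat X (X *ᵥ β) = β := by
  rw [betaHat, Matrix.mulVec_mulVec, Matrix.mulVec_mulVec, Matrix.mul_assoc,
    Matrix.nonsing_inv_mul _ (isUnit_det_transpose_mul_self hX), Matrix.one_mulVec]

lemma betaHat_sub {m p : ℕ} (X : Matrix (Fin m) (Fin p) ℝ) (y z : Fin m → ℝ) :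
    betaHat X (y - z) = betaHat X y - betaHat X z := by
  simp [betaHat, Matrix.mulVec_sub]

lemma leverage_eq {m p : ℕ} (X : Matrix (Fin m) (Fin p) ℝ) (i : Fin m) :
    leverage X i = (X *ᵥ betaHat X (Pi.single i 1)) i := by
  rw [leverage, betaHat, Matrix.mulVec_single_one]
  rfl

/-- The column space of `X` in Euclidean space. -/
def columnSpace {m p : ℕ} (X : Matrix (Fin m) (Fin p) ℝ) :
    Submodule ℝ (EuclideanSpace ℝ (Fin m)) :=
  X.mulVecLin.range.map ((WithLp.linearEquiv 2 ℝ (Fin m → ℝ)).symm : (Fin m → ℝ) →ₗ[ℝ] _)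

lemma finrank_columnSpace {m p : ℕ} (X : Matrix (Fin m) (Fin p) ℝ) :
    Module.finrank ℝ (columnSpace X) = X.rank :=
  LinearEquiv.finrank_map_eq _ _

/-- The normal equations: `Xᵀ (y - X β̂) = 0`, so the residual is orthogonal to every `X b`. -/
lemma starProjection_columnSpace {m p : ℕ} {X : Matrix (Fin m) (Fin p) ℝ} (hX : X.rank = p)
    (y : Fin m → ℝ) :
    (columnSpace X).starProjection (WithLp.toLp 2 y) = WithLp.toLp 2 (X *ᵥ betaHat X y) := by
  refine (Submodule.eq_starProjection_of_mem_of_inner_eq_zero ?_ ?_)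
  · exact ⟨_, ⟨betaHat X y, rfl⟩, rfl⟩
  · rintro _ ⟨_, ⟨b, rfl⟩, rfl⟩
    change inner ℝ (WithLp.toLp 2 y - WithLp.toLp 2 (X *ᵥ betaHat X y)) (WithLp.toLp 2 (X *ᵥ b)) = 0
    rw [← WithLp.toLp_sub, EuclideanSpace.inner_toLp_toLp, star_trivial, dotProduct_comm,
      Matrix.dotProduct_mulVec, ← Matrix.mulVec_transpose, Matrix.mulVec_sub, betaHat,
      Matrix.mulVec_mulVec, Matrix.mulVec_mulVec,
      Matrix.mul_nonsing_inv _ (isUnit_det_transpose_mul_self hX)]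
    simp

/-- Orthonormal coordinates adapted to the column space of `X` and its complement. -/
lemma exists_adapted_orthonormal {m p : ℕ} {X : Matrix (Fin m) (Fin p) ℝ} (hX : X.rank = p) :
    ∃ (e : Fin p → Fin m → ℝ) (f : Fin (m - p) → Fin m → ℝ),
      (∀ j k, ∑ i, e j i * e k i = if j = k then 1 else 0) ∧
      (∀ j k, ∑ i, f j i * f k i = if j = k then 1 else 0) ∧
      (∀ j k, ∑ i, e j i * f k i = 0) ∧
      (∀ y i, (X *ᵥ betaHat X y) i = ∑ j, e j i * ∑ l, e j l * y l) ∧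
      (∀ y i, y i - (X *ᵥ betaHat X y) i = ∑ j, f j i * ∑ l, f j l * y l) := by
  have hK : Module.finrank ℝ (columnSpace X) = p := (finrank_columnSpace X).trans hX
  have hK' : Module.finrank ℝ (columnSpace X)ᗮ = m - p := by
    have := (columnSpace X).finrank_add_finrank_orthogonal
    rw [finrank_euclideanSpace_fin, hK] at this
    omega
  let b := (stdOrthonormalBasis ℝ (columnSpace X)).reindex (finCongr hK)
  let c := (stdOrthonormalBasis ℝ (columnSpace X)ᗮ).reindex (finCongr hK')
  have hinner : ∀ x y : EuclideanSpace ℝ (Fin m), inner ℝ x y = ∑ i, x i * y i := fun x y => by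
    simp [PiLp.inner_apply, mul_comm]
  refine ⟨fun j => (b j : EuclideanSpace ℝ (Fin m)), fun j => (c j : EuclideanSpace ℝ (Fin m)),
    fun j k => ?_, fun j k => ?_, fun j k => ?_, fun y i => ?_, fun y i => ?_⟩
  · rw [← hinner]
    exact orthonormal_iff_ite.mp b.orthonormal j k
  · rw [← hinner]
    exact orthonormal_iff_ite.mp c.orthonormal j k
  · rw [← hinner]
    exact (c k).2 _ (b j).2
  · have h := congrArg (fun z : EuclideanSpace ℝ (Fin m) => z i) (starProjection_columnSpace hX y)
    simp only [b.starProjection_eq_sum_rankOne] at h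
    simpa [hinner, mul_comm] using h.symm
  · have h := congrArg (fun z : EuclideanSpace ℝ (Fin m) => z i)
      ((columnSpace X).starProjection_orthogonal_val (WithLp.toLp 2 y))
    simp only [c.starProjection_eq_sum_rankOne, starProjection_columnSpace hX] at h
    simpa [hinner, mul_comm] using h.symm

/-! ### The estimation error in canonical coordinates -/

/-- The coefficients, in terms of the random effects and the sampling errors, of the independent
coordinates in which the estimation error of `θ i` is expanded. -/
noncomputable def errorCoeff {m p n : ℕ} (B : ℝ) (e : Fin p → Fin m → ℝ) (f : Fin n → Fin m → ℝ)
    (i : Fin m) : Option (Fin p) ⊕ Fin n → Fin m ⊕ Fin m → ℝ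
  | .inl none => Sum.elim (fun l => if l = i then B else 0) (fun l => if l = i then -(1 - B) else 0)
  | .inl (some j) => Sum.elim (e j) (e j)
  | .inr j => Sum.elim (f j) (f j)

/-- Parseval's identity for the residual in the orthonormal family `f`. -/
lemma residualSS_eq {m p : ℕ} {X : Matrix (Fin m) (Fin p) ℝ} {n : ℕ} {f : Fin n → Fin m → ℝ}
    (hf : ∀ j k, ∑ i, f j i * f k i = if j = k then 1 else 0)
    (hres : ∀ y i, y i - (X *ᵥ betaHat X y) i = ∑ j, f j i * ∑ l, f j l * y l) (y : Fin m → ℝ) :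
    residualSS X y = ∑ j, (∑ l, f j l * y l) ^ 2 := by
  rw [residualSS, EuclideanSpace.norm_sq_eq]
  simp only [Pi.sub_apply, hres, Real.norm_eq_abs, sq_abs]
  simp_rw [pow_two (∑ j, f j _ * _), Finset.sum_mul_sum]
  rw [Finset.sum_comm]
  refine Finset.sum_congr rfl fun j _ => ?_
  rw [Finset.sum_comm]
  have h : ∀ k, ∑ i, f j i * (∑ l, f j l * y l) * (f k i * ∑ l, f k l * y l)
      = (if j = k then 1 else 0) * ((∑ l, f j l * y l) * ∑ l, f k l * y l) := fun k => by
    rw [← hf, Finset.sum_mul]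
    exact Finset.sum_congr rfl fun i _ => by ring
  simp_rw [h]
  simp [pow_two]

/-- The vector `X β` has zero residual, so its residual sum of squares vanishes term by term. Hence
the `f`-coordinates of `y` and `y - X β` agree. -/
lemma sum_mul_mulVec_eq_zero {m p : ℕ} {X : Matrix (Fin m) (Fin p) ℝ} (hX : X.rank = p) {n : ℕ}
    {f : Fin n → Fin m → ℝ} (hf : ∀ j k, ∑ i, f j i * f k i = if j = k then 1 else 0)
    (hres : ∀ y i, y i - (X *ᵥ betaHat X y) i = ∑ j, f j i * ∑ l, f j l * y l) (β : Fin p → ℝ)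
    (j : Fin n) : ∑ l, f j l * (X *ᵥ β) l = 0 := by
  have h := residualSS_eq hf hres (X *ᵥ β)
  rw [residualSS, betaHat_mulVec hX, sub_self, WithLp.toLp_zero, norm_zero] at h
  have h0 : ∑ j, (∑ l, f j l * (X *ᵥ β) l) ^ 2 = 0 := by rw [← h]; simp
  rw [Finset.sum_eq_zero_iff_of_nonneg fun _ _ => sq_nonneg _] at h0
  exact pow_eq_zero_iff two_ne_zero |>.mp (h0 j (Finset.mem_univ j))

/-- Add and subtract `B (y - X β)`, then split `y - X β` into its fitted part `X β̂ - X β` and the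
residual `y - X β̂`. -/
lemma error_eq_canonical {m p : ℕ} {X : Matrix (Fin m) (Fin p) ℝ} (hX : X.rank = p) {n : ℕ}
    {e : Fin p → Fin m → ℝ} {f : Fin n → Fin m → ℝ}
    (hf : ∀ j k, ∑ i, f j i * f k i = if j = k then 1 else 0)
    (hfit : ∀ y i, (X *ᵥ betaHat X y) i = ∑ j, e j i * ∑ l, e j l * y l)
    (hres : ∀ y i, y i - (X *ᵥ betaHat X y) i = ∑ j, f j i * ∑ l, f j l * y l)
    (β : Fin p → ℝ) (V : ℝ≥0) (B : ℝ) (i : Fin m) (θ y : Fin m → ℝ)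
    {U : Option (Fin p) ⊕ Fin n → ℝ}
    (hU : ∀ k, U k = ∑ s, errorCoeff B e f i k s * (Sum.elim (θ - X *ᵥ β) (y - θ) s : ℝ)) :
    θ i - thetaHatEB X V y i
      = ∑ k : Option (Fin p), (k.elim 1 fun j => -(B * e j i)) * U (.inl k)
        + ∑ j, f j i * (U (.inr j)
          * ((V : ℝ) * ((m : ℝ) - p - 2) * (∑ l, U (.inr l) ^ 2)⁻¹ - B)) := by
  have hU0 : U (.inl none) = B * (θ i - (X *ᵥ β) i) - (1 - B) * (y i - θ i) := by
    rw [hU, Fintype.sum_sum_type]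
    simp [errorCoeff]
    ring
  have hU1 : ∀ j, U (.inl (some j)) = ∑ l, e j l * (y - X *ᵥ β) l := fun j => by
    rw [hU, Fintype.sum_sum_type, ← Finset.sum_add_distrib]
    refine Finset.sum_congr rfl fun l _ => ?_
    simp only [errorCoeff, Sum.elim_inl, Sum.elim_inr, Pi.sub_apply]
    ring
  have hU2 : ∀ j, U (.inr j) = ∑ l, f j l * y l := fun j => by
    rw [hU, Fintype.sum_sum_type, ← Finset.sum_add_distrib,
      -- The zero subtracted is the `f j`-coordinate of `X β`, which turns `y` into `y - X β`.
      ← sub_zero (∑ l, f j l * y l), ← sum_mul_mulVec_eq_zero hX hf hres β j,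
      ← Finset.sum_sub_distrib]
    refine Finset.sum_congr rfl fun l _ => ?_
    simp only [errorCoeff, Sum.elim_inl, Sum.elim_inr, Pi.sub_apply]
    ring
  have hfit' := hfit (y - X *ᵥ β) i
  simp_rw [← hU1] at hfit'
  rw [betaHat_sub, betaHat_mulVec hX, Matrix.mulVec_sub, Pi.sub_apply] at hfit'
  have hres' := hres y i
  simp_rw [← hU2] at hres'
  have hS : residualSS X y = ∑ l, U (.inr l) ^ 2 := by
    rw [residualSS_eq hf hres]
    simp_rw [hU2]
  have h1 : ∑ j, -(B * e j i) * U (.inl (some j)) = -B * ((X *ᵥ betaHat X y) i - (X *ᵥ β) i) := by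
    rw [hfit', Finset.mul_sum]
    exact Finset.sum_congr rfl fun j _ => by ring
  have h2 : ∑ j, f j i * (U (.inr j)
      * ((V : ℝ) * ((m : ℝ) - p - 2) * (∑ l, U (.inr l) ^ 2)⁻¹ - B))
      = ((V : ℝ) * ((m : ℝ) - p - 2) * (∑ l, U (.inr l) ^ 2)⁻¹ - B)
        * (y i - (X *ᵥ betaHat X y) i) := by
    rw [hres', Finset.mul_sum]
    exact Finset.sum_congr rfl fun j _ => by ring
  rw [Fintype.sum_option]
  simp only [Option.elim_none, Option.elim_some]
  rw [h1, h2, hU0, ← hS]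
  simp only [thetaHatEB, shrinkageHatEB, Pi.add_apply, Pi.smul_apply, smul_eq_mul, div_eq_mul_inv]
  ring

/-- The variances of the coordinates given by `errorCoeff`. -/
noncomputable def errorVar {p : ℕ} (V A : ℝ≥0) : Option (Fin p) → ℝ≥0
  | none => V * A / (V + A)
  | some _ => V + A

/-- Only second moments need checking. Orthonormality handles the `e` and `f` coordinates; their
covariance with the first coordinate is a multiple of `B A - (1 - B) V`, which is zero for `B = V /
(V + A)`. -/
lemma hasLaw_errorCoeff {Ω : Type*} [MeasurableSpace Ω] {P : Measure Ω} [IsProbabilityMeasure P]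
    {m p n : ℕ} {e : Fin p → Fin m → ℝ} {f : Fin n → Fin m → ℝ}
    (he : ∀ j k, ∑ i, e j i * e k i = if j = k then 1 else 0)
    (hf : ∀ j k, ∑ i, f j i * f k i = if j = k then 1 else 0)
    (hef : ∀ j k, ∑ i, e j i * f k i = 0) {V A : ℝ≥0} (hV : 0 < V) (i : Fin m)
    {N : Ω → Fin m ⊕ Fin m → ℝ}
    (hN : HasLaw N (Measure.pi fun s => gaussianReal 0 (Sum.elim (fun _ => A) (fun _ => V) s)) P) :
    HasLaw (fun ω k => ∑ s, errorCoeff (shrinkage V A) e f i k s * N ω s)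
      (Measure.pi fun k => gaussianReal 0 (Sum.elim (errorVar V A) (fun _ => V + A) k)) P := by
  have hV' : (0 : ℝ) < V := hV
  have hVA : (V : ℝ) + A ≠ 0 := by positivity
  have hsum : ∀ g h : Fin m → ℝ, ∑ l, g l * h l * (A : ℝ) + ∑ l, g l * h l * (V : ℝ)
      = (∑ l, g l * h l) * (V + A) := fun g h => by
    rw [← Finset.sum_mul, ← Finset.sum_mul]
    ring
  have hzero : ∀ g : Fin m → ℝ,
      shrinkage V A * g i * A + (shrinkage V A - 1) * g i * V = 0 := fun g => by
    rw [shrinkage]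
    field_simp
    ring
  have hzero' : ∀ g : Fin m → ℝ,
      g i * shrinkage V A * A + g i * (shrinkage V A - 1) * V = 0 := fun g => by
    rw [← hzero g]
    ring
  have hfe : ∀ j k, ∑ i, f j i * e k i = 0 := fun j k => by
    simpa only [mul_comm] using hef k j
  refine hasLaw_linear_combination_pi_gaussianReal hN _ _ ?_ ?_
  · rintro ((_ | j) | j)
    · rw [Fintype.sum_sum_type]
      simp only [errorCoeff, errorVar, Sum.elim_inl, Sum.elim_inr, ite_pow, ite_mul, zero_mul, Finset.sum_ite_eq', Finset.mem_univ, if_true,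
        ne_eq, OfNat.ofNat_ne_zero, not_false_eq_true, zero_pow, shrinkage]
      push_cast
      field_simp
      ring
    · rw [Fintype.sum_sum_type]
      simp only [errorCoeff, errorVar, Sum.elim_inl, Sum.elim_inr, pow_two]
      rw [hsum, he]
      simp
    · rw [Fintype.sum_sum_type]
      simp only [errorCoeff, Sum.elim_inl, Sum.elim_inr, pow_two]
      rw [hsum, hf]
      simp
  · rintro ((_ | j) | j) ((_ | k) | k) hjk <;> rw [Fintype.sum_sum_type] <;>
      simp only [errorCoeff, Sum.elim_inl, Sum.elim_inr]
    · exact absurd rfl hjk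
    · simpa using hzero (e k)
    · simpa using hzero (f k)
    · simpa using hzero' (e j)
    · rw [hsum, he, if_neg (by rintro rfl; exact hjk rfl), zero_mul]
    · rw [hsum, hef, zero_mul]
    · simpa using hzero' (f j)
    · rw [hsum, hfe, zero_mul]
    · rw [hsum, hf, if_neg (by rintro rfl; exact hjk rfl), zero_mul]

/-- The leverage is a diagonal entry of the projection matrix, hence the squared norm of the
projected unit vector. -/
lemma leverage_eq_sum_sq {m p : ℕ} {X : Matrix (Fin m) (Fin p) ℝ} {e : Fin p → Fin m → ℝ}
    (hfit : ∀ y i, (X *ᵥ betaHat X y) i = ∑ j, e j i * ∑ l, e j l * y l) (i : Fin m) :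
    leverage X i = ∑ j, e j i ^ 2 := by
  rw [leverage_eq, hfit]
  simp [Pi.single_apply, pow_two]

lemma one_sub_leverage_eq_sum_sq {m p n : ℕ} {X : Matrix (Fin m) (Fin p) ℝ}
    {f : Fin n → Fin m → ℝ}
    (hres : ∀ y i, y i - (X *ᵥ betaHat X y) i = ∑ j, f j i * ∑ l, f j l * y l) (i : Fin m) :
    1 - leverage X i = ∑ j, f j i ^ 2 := by
  have h := hres (Pi.single i 1) i
  rw [← leverage_eq] at h
  simpa [Pi.single_apply, pow_two] using h

/-- The trace of the projection: each of the `p` unit vectors `e j` contributes one. -/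
lemma sum_leverage {m p : ℕ} {X : Matrix (Fin m) (Fin p) ℝ} (hX : X.rank = p) :
    ∑ i, leverage X i = p := by
  obtain ⟨e, f, he, -, -, hfit, -⟩ := exists_adapted_orthonormal hX
  simp_rw [leverage_eq_sum_sq hfit]
  rw [Finset.sum_comm]
  simp_rw [pow_two, he]
  simp

/-! ### Mean squared errors -/

/-- The mean squared error of the empirical Bayes estimator of a single `θ i`. -/
lemma IsAreaLevelModel.mse_thetaHatEB {Ω : Type*} [MeasurableSpace Ω] {P : Measure Ω}
    [IsProbabilityMeasure P] {m p : ℕ} (hmp : p + 2 < m)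
    {X : Matrix (Fin m) (Fin p) ℝ} (hX : X.rank = p) {β : Fin p → ℝ}
    {V A : ℝ≥0} (hV : 0 < V) {θ y : Ω → Fin m → ℝ} (h : IsAreaLevelModel P X β V A θ y)
    (i : Fin m) :
    Integrable (fun ω => (θ ω i - thetaHatEB X V (y ω) i) ^ 2) P ∧
    ∫ ω, (θ ω i - thetaHatEB X V (y ω) i) ^ 2 ∂P =
      V * (1 - shrinkage V A) + V * shrinkage V A * leverage X i
        + 2 * V * shrinkage V A * (1 - leverage X i) / ((m : ℝ) - p) := by
  obtain ⟨e, f, he, hf, hef, hfit, hres⟩ := exists_adapted_orthonormal hX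
  have hlaw := hasLaw_errorCoeff he hf hef hV i h.hasLaw_errors
  have hcard : ((Fintype.card (Fin (m - p)) : ℕ) : ℝ) = m - p := by
    rw [Fintype.card_fin, Nat.cast_sub (by omega)]
  have hmain := integral_sq_canonical_error (η := Fin (m - p)) (by rw [Fintype.card_fin]; omega)
    (errorVar (p := p) V A) (v := V + A) (by positivity) ((V : ℝ) * ((m : ℝ) - p - 2))
    (shrinkage V A) (fun k => k.elim 1 fun j => -(shrinkage V A * e j i)) (fun j => f j i)
  set F : (Option (Fin p) ⊕ Fin (m - p) → ℝ) → ℝ := fun x =>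
    ∑ k : Option (Fin p), (k.elim 1 fun j => -(shrinkage V A * e j i)) * x (.inl k)
      + ∑ j, f j i * (x (.inr j)
        * ((V : ℝ) * ((m : ℝ) - p - 2) * (∑ l, x (.inr l) ^ 2)⁻¹ - shrinkage V A)) with hF
  have hFU : ∀ ω, θ ω i - thetaHatEB X V (y ω) i
      = F (fun k => ∑ s, errorCoeff (shrinkage V A) e f i k s
        * (Sum.elim (θ ω - X *ᵥ β) (y ω - θ ω) s : ℝ)) := fun ω =>
    error_eq_canonical hX hf hfit hres β V (shrinkage V A) i (θ ω) (y ω) fun _ => rfl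
  have hint := hmain.1.integrable_sq
  simp_rw [hFU]
  constructor
  · rw [← hlaw.map_eq] at hint
    exact hint.comp_aemeasurable hlaw.aemeasurable
  · refine (hlaw.integral_comp (f := fun x => F x ^ 2) hint.aestronglyMeasurable).trans
      (hmain.2.trans ?_)
    -- With `c = V (m - p - 2)`, `v = V + A` and `b = B`, the last factor of the canonical formula
    -- becomes `2 V B / (m - p)`.
    rw [hcard, ← one_sub_leverage_eq_sum_sq hres, Fintype.sum_option]
    simp only [Option.elim_none, Option.elim_some, errorVar, neg_sq, mul_pow]
    rw [← Finset.sum_mul, ← Finset.mul_sum, ← leverage_eq_sum_sq hfit]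
    have hV' : (0 : ℝ) < V := hV
    have hVA : (V : ℝ) + A ≠ 0 := by positivity
    have hm : (p : ℝ) + 2 < m := by exact_mod_cast hmp
    have hm1 : (m : ℝ) - p ≠ 0 := by linarith
    have hm2 : (m : ℝ) - p - 2 ≠ 0 := by linarith
    push_cast
    rw [shrinkage]
    field_simp
    ring

end AreaLevel

theorem theorem3 {Ω : Type*} [MeasurableSpace Ω] (P : Measure Ω) [IsProbabilityMeasure P]
    (m p : ℕ) (hmp : p + 2 < m)
    (X : Matrix (Fin m) (Fin p) ℝ) (hX : X.rank = p) (β : Fin p → ℝ)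
    (V A : ℝ≥0) (hV : 0 < V)
    (θ y : Ω → Fin m → ℝ) (hmodel : AreaLevel.IsAreaLevelModel P X β V A θ y) :
    (∀ i : Fin m,
      Integrable (fun ω => (θ ω i - AreaLevel.thetaHatEB X V (y ω) i) ^ 2) P ∧
      ∫ ω, (θ ω i - AreaLevel.thetaHatEB X V (y ω) i) ^ 2 ∂P =
        V * (1 - AreaLevel.shrinkage V A)
          + V * AreaLevel.shrinkage V A * AreaLevel.leverage X i
          + 2 * V * AreaLevel.shrinkage V A * (1 - AreaLevel.leverage X i) / ((m : ℝ) - p)) ∧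
    (Integrable (fun ω => ‖WithLp.toLp 2 (θ ω - AreaLevel.thetaHatEB X V (y ω))‖ ^ 2) P ∧
      ∫ ω, ‖WithLp.toLp 2 (θ ω - AreaLevel.thetaHatEB X V (y ω))‖ ^ 2 ∂P =
        V * ((m : ℝ) - ((m : ℝ) - p - 2) * AreaLevel.shrinkage V A)) := by
  have h := fun i => hmodel.mse_thetaHatEB hmp hX hV i
  refine ⟨h, ?_⟩
  simp_rw [EuclideanSpace.norm_sq_eq, Real.norm_eq_abs, sq_abs, Pi.sub_apply]
  refine ⟨integrable_finsetSum _ fun i _ => (h i).1, ?_⟩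
  have hm : (p : ℝ) + 2 < m := by exact_mod_cast hmp
  have hm1 : (m : ℝ) - p ≠ 0 := by linarith
  -- This sum cancels the denominator `m - p`, so the last terms add up to `2 V B`.
  have hres : ∑ i, (1 - AreaLevel.leverage X i) = (m : ℝ) - p := by
    rw [Finset.sum_sub_distrib, AreaLevel.sum_leverage hX]
    simp
  rw [integral_finsetSum _ fun i _ => (h i).1, Finset.sum_congr rfl fun i _ => (h i).2,
    Finset.sum_add_distrib, Finset.sum_add_distrib, ← Finset.sum_div, ← Finset.mul_sum,
    ← Finset.mul_sum, ← Finset.mul_sum, hres, AreaLevel.sum_leverage hX]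
  simp only [Finset.sum_const, Finset.card_univ, Fintype.card_fin, nsmul_eq_mul]
  field_simp
  ring
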